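/- For non-negative integers $n_1,n_2,m$ let $$A(n_1,n_2,m)=\frac{(2m+n_1+n_2+1)(2m+n_1+n_2)}{2}+m(n_1+n_2)+(n_1+n_2)^2-n_1,$$ and for $n\ge 0$ let $(a;q)_n=\prod_{i=0}^{n-1}(1-aq^i)$ and $(q)_n=(q;q)_n$. Call a partition (a finite non-decreasing sequence of positive integers, the empty one included) a Schur partition if any two consecutive parts $a\le b$ satisfy $b-a\ge 3$, and moreover $b-a\ge 6$ whenever $a$ and $b$ are both multiples of $3$. Then, as an identity of formal power series in $x$ and $q$ (the left-hand side converging unconditionally, coefficient by coefficient), $$\sum_{n_1,n_2,m\ge 0}\frac{x^{n_1+n_2+m}\,q^{A(n_1,n_2,m)}}{(q^6;q^6)_{\lfloor n_1/2\rfloor}\,(q^6;q^6)_{\lfloor n_2/2\rfloor}\,(q)_m}=\sum_{k,n\ge 0}s(k,n)\,x^kq^n,$$ where $s(k,n)$ is the number of Schur partitions of $n$ into exactly $k$ parts. -/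

import Mathlib

open scoped MvPowerSeries.WithPiTopology

namespace SchurGap

/-- Schur's gap conditions on a partition: listing the parts in non-decreasing order, any two
neighbouring parts `a`, `b` satisfy `b - a ≥ 3`, and `b - a ≥ 6` if both are multiples of `3`. -/
def IsSchur {n : ℕ} (p : n.Partition) : Prop :=
  (p.parts.sort (· ≤ ·)).IsChain (fun a b => a + 3 ≤ b ∧ (3 ∣ a → 3 ∣ b → a + 6 ≤ b))

instance {n : ℕ} (p : n.Partition) : Decidable (IsSchur p) := by
  unfold IsSchur; infer_instance

/-- The number of partitions of `n` into exactly `k` parts satisfying Schur's gap conditions. -/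
def schurCount (k n : ℕ) : ℕ :=
  Fintype.card {p : n.Partition // IsSchur p ∧ p.parts.card = k}

/-- Formal power series in two variables over `ℤ` (a discrete ring, so that the product topology
is that of eventual constancy of each coefficient). -/
abbrev Series : Type := MvPowerSeries (Fin 2) ℤ

/-- The variable that counts parts. -/
noncomputable def x : Series := MvPowerSeries.X 0

/-- The variable that records the size. -/
noncomputable def q : Series := MvPowerSeries.X 1

/-- The generating function `∑ x ^ (number of parts) * q ^ (size)` of all partitions satisfying
Schur's gap conditions: the coefficient of `x ^ k * q ^ n` is `schurCount k n`. -/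
def schurGF : Series := fun d => (schurCount (d 0) (d 1) : ℤ)

/-- The finite `q`-Pochhammer symbol `(a; b)_n = (1 - a) (1 - a b) ⋯ (1 - a b ^ (n - 1))`. -/
def qPochhammer {R : Type*} [CommRing R] (a b : R) (n : ℕ) : R :=
  ∏ i ∈ Finset.range n, (1 - a * b ^ i)

/-- The reciprocal of a power series with constant coefficient `1`. -/
noncomputable def recip (f : Series) : Series := MvPowerSeries.invOfUnit f 1

/-- The exponent `A(n₁, n₂, m)`. Both the division and the subtraction are exact. -/
def A (n₁ n₂ m : ℕ) : ℕ :=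
  (2 * m + n₁ + n₂ + 1) * (2 * m + n₁ + n₂) / 2 + m * (n₁ + n₂) + (n₁ + n₂) ^ 2 - n₁

theorem A_cast (n₁ n₂ m : ℕ) :
    (A n₁ n₂ m : ℚ) = (2 * m + n₁ + n₂ + 1) * (2 * m + n₁ + n₂) / 2 + m * (n₁ + n₂)
      + (n₁ + n₂) ^ 2 - n₁ := by
  have h2 : 2 ∣ (2 * m + n₁ + n₂ + 1) * (2 * m + n₁ + n₂) := by
    rw [mul_comm]; exact (Nat.even_mul_succ_self _).two_dvd
  have h1 : n₁ + n₂ ≤ (n₁ + n₂) ^ 2 := Nat.le_self_pow (by norm_num) _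
  have h : n₁ ≤ (2 * m + n₁ + n₂ + 1) * (2 * m + n₁ + n₂) / 2 + m * (n₁ + n₂)
      + (n₁ + n₂) ^ 2 := by
    generalize (2 * m + n₁ + n₂ + 1) * (2 * m + n₁ + n₂) / 2 = u
    generalize m * (n₁ + n₂) = v
    omega
  rw [A, Nat.cast_sub h, Nat.cast_add, Nat.cast_add, Nat.cast_div h2 (by norm_num)]
  push_cast
  ring

/-- The denominator `(q⁶; q⁶)_⌊n₁/2⌋ (q⁶; q⁶)_⌊n₂/2⌋ (q; q)_m`. -/
noncomputable def denom (n₁ n₂ m : ℕ) : Series :=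
  qPochhammer (q ^ 6) (q ^ 6) (n₁ / 2) * qPochhammer (q ^ 6) (q ^ 6) (n₂ / 2) * qPochhammer q q m

/-- The denominators are invertible, and `recip` gives their inverses. -/
theorem denom_mul_recip (n₁ n₂ m : ℕ) : denom n₁ n₂ m * recip (denom n₁ n₂ m) = 1 := by
  apply MvPowerSeries.mul_invOfUnit
  simp [denom, qPochhammer, q, map_prod]

/-- The general term of the triple series,
`x ^ (n₁ + n₂ + m) q ^ A(n₁, n₂, m) / ((q⁶; q⁶)_⌊n₁/2⌋ (q⁶; q⁶)_⌊n₂/2⌋ (q; q)_m)`. -/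
noncomputable def summand (n₁ n₂ m : ℕ) : Series :=
  x ^ (n₁ + n₂ + m) * q ^ A n₁ n₂ m * recip (denom n₁ n₂ m)

end SchurGap

namespace SchurGap

/-! ### The sum side -/

/-! Fix `k = n₁ + n₂ + m`, the exponent of `x`. By `A_eq`, the terms share the factor `q ^ (k + 3 *
k.choose 2)`, the weight of the least Schur partition 1, 4, 7, ..., 3k - 2. What remains is the
coefficient of `z ^ k` in F(z) = E(z) H(z) H(qz), with E = `eulerSeries` and H = `halfSeries`.
Morally E(z) = (-zq²; q)_∞ and H(z) = (1 + z) / (z²; q⁶)_∞. Hence (1 + q²z) F(q³z) = (1 - z)(1 - qz)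
F(z), a three-term recurrence in `k` (`tripleCoeff_recurrence`). Splitting Schur partitions by
smallest part 1, 2 or 3, and shifting parts by 3, yields the same recurrence up to that factor
(`partsGF_recurrence`). Initial values agree, so induction gives `partsGF_eq_tripleCoeff`. -/

theorem qPochhammer_succ {R : Type*} [CommRing R] (a b : R) (n : ℕ) :
    qPochhammer a b (n + 1) = qPochhammer a b n * (1 - a * b ^ n) :=
  Finset.prod_range_succ _ _

theorem constantCoeff_qPochhammer {a : Series} (ha : MvPowerSeries.constantCoeff a = 0)
    (b : Series) (n : ℕ) : MvPowerSeries.constantCoeff (qPochhammer a b n) = 1 := by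
  simp [qPochhammer, map_prod, ha]

theorem mul_recip {f : Series} (hf : MvPowerSeries.constantCoeff f = 1) : f * recip f = 1 :=
  MvPowerSeries.mul_invOfUnit f 1 (by simpa using hf)

theorem recip_eq_of_mul_eq_one {f g : Series} (hf : MvPowerSeries.constantCoeff f = 1)
    (h : f * g = 1) : recip f = g := by
  calc recip f = recip f * (f * g) := by rw [h, mul_one]
    _ = (f * recip f) * g := by ring
    _ = g := by rw [mul_recip hf, one_mul]

theorem recip_one : recip 1 = 1 := recip_eq_of_mul_eq_one (by simp) (by simp)

theorem recip_mul {f g : Series} (hf : MvPowerSeries.constantCoeff f = 1)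
    (hg : MvPowerSeries.constantCoeff g = 1) : recip (f * g) = recip f * recip g := by
  apply recip_eq_of_mul_eq_one (by simp [hf, hg])
  calc f * g * (recip f * recip g) = (f * recip f) * (g * recip g) := by ring
    _ = 1 := by rw [mul_recip hf, mul_recip hg, one_mul]

theorem constantCoeff_q : MvPowerSeries.constantCoeff q = 0 := by simp [q]

theorem constantCoeff_q_pow {n : ℕ} (hn : n ≠ 0) :
    MvPowerSeries.constantCoeff (q ^ n) = 0 := by simp [q, hn]

theorem recip_qPochhammer_succ {a : Series} (ha : MvPowerSeries.constantCoeff a = 0)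
    (b : Series) (n : ℕ) :
    (1 - a * b ^ n) * recip (qPochhammer a b (n + 1)) = recip (qPochhammer a b n) := by
  rw [qPochhammer_succ, recip_mul (constantCoeff_qPochhammer ha b n) (by simp [ha]), mul_left_comm,
    mul_recip (by simp [ha]), mul_one]

/-- The coefficients `1 / (q⁶; q⁶)_⌊n/2⌋`. -/
noncomputable def halfCoeff (n : ℕ) : Series := recip (qPochhammer (q ^ 6) (q ^ 6) (n / 2))

/-- The coefficients `q ^ (m (m + 3) / 2) / (q; q)_m` of Euler's product `(-z q²; q)_∞`. -/
noncomputable def eulerCoeff (m : ℕ) : Series :=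
  q ^ (m.choose 2 + 2 * m) * recip (qPochhammer q q m)

theorem choose_two_succ (k : ℕ) : (k + 1).choose 2 = k + k.choose 2 := by
  rw [Nat.choose_succ_succ' k 1, Nat.choose_one_right]

theorem eulerCoeff_succ (m : ℕ) :
    (1 - q ^ (m + 1)) * eulerCoeff (m + 1) = q ^ (m + 2) * eulerCoeff m := by
  have h := recip_qPochhammer_succ constantCoeff_q q m
  rw [eulerCoeff, eulerCoeff, choose_two_succ, ← h]
  ring

theorem halfCoeff_even (a : ℕ) : halfCoeff (2 * a) = recip (qPochhammer (q ^ 6) (q ^ 6) a) := by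
  rw [halfCoeff, Nat.mul_div_cancel_left a two_pos]

theorem halfCoeff_odd (a : ℕ) : halfCoeff (2 * a + 1) = halfCoeff (2 * a) := by
  rw [halfCoeff, halfCoeff]
  congr 2
  omega

theorem halfCoeff_even_succ (a : ℕ) :
    (1 - q ^ (6 * a + 6)) * halfCoeff (2 * a + 2) = halfCoeff (2 * a) := by
  have h := recip_qPochhammer_succ (constantCoeff_q_pow (n := 6) (by norm_num)) (q ^ 6) a
  rw [show 2 * a + 2 = 2 * (a + 1) by ring, halfCoeff_even, halfCoeff_even, ← h]
  ring

/-- Coefficientwise form of H(q³z) = (1 + q³z)(1 - z) H(z). In either parity two of the three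
coefficients coincide, leaving one step of the Pochhammer product. -/
theorem halfCoeff_recurrence (n : ℕ) :
    q ^ (3 * (n + 2)) * halfCoeff (n + 2)
      = halfCoeff (n + 2) + (q ^ 3 - 1) * halfCoeff (n + 1) - q ^ 3 * halfCoeff n := by
  obtain ⟨a, rfl | rfl⟩ := Nat.even_or_odd' n
  · rw [halfCoeff_odd]
    linear_combination -halfCoeff_even_succ a
  · have h1 : halfCoeff (2 * a + 1 + 2) = halfCoeff (2 * a + 2) := halfCoeff_odd (a + 1)
    rw [h1, show 2 * a + 1 + 1 = 2 * a + 2 by ring, halfCoeff_odd]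
    linear_combination -q ^ 3 * halfCoeff_even_succ a

/-- The series `∑ z ^ n / (q⁶; q⁶)_⌊n/2⌋` in a third variable `z`. -/
noncomputable def halfSeries : PowerSeries Series := PowerSeries.mk halfCoeff

/-- Euler's series `∑ z ^ m q ^ (m (m + 3) / 2) / (q; q)_m` in a third variable `z`. -/
noncomputable def eulerSeries : PowerSeries Series := PowerSeries.mk eulerCoeff

open PowerSeries in
theorem constantCoeff_rescale {R : Type*} [CommRing R] (a : R) (f : PowerSeries R) :
    constantCoeff (rescale a f) = constantCoeff f := by
  rw [← coeff_zero_eq_constantCoeff_apply, coeff_rescale, pow_zero, one_mul,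
    coeff_zero_eq_constantCoeff_apply]

open PowerSeries in
theorem rescale_halfSeries :
    rescale (q ^ 3) halfSeries = (1 + C (q ^ 3) * X) * (1 - X) * halfSeries := by
  -- Keeping `a` opaque stops `map_sub` from splitting `C a`.
  obtain ⟨a, ha⟩ : ∃ a, a = q ^ 3 - 1 := ⟨_, rfl⟩
  have e : (1 + C (q ^ 3) * X) * (1 - X) * halfSeries = halfSeries
      + X * (C a * halfSeries - C (q ^ 3) * (X * halfSeries)) := by
    rw [ha, map_sub (C (R := Series)), map_one]; ring
  rw [e]
  ext1 n
  rcases n with _ | _ | n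
  · simp [halfSeries]
  · have h : halfCoeff 1 = halfCoeff 0 := halfCoeff_odd 0
    simp only [halfSeries, coeff_rescale, map_add, map_sub, coeff_succ_X_mul, coeff_zero_X_mul,
      coeff_C_mul, coeff_mk, zero_add, h]
    rw [ha]
    ring
  · have h := halfCoeff_recurrence n
    simp only [halfSeries, coeff_rescale, map_add, map_sub, coeff_succ_X_mul, coeff_C_mul,
      coeff_mk, ← pow_mul]
    rw [ha]
    linear_combination h

open PowerSeries in
theorem eulerSeries_eq_mul_rescale :
    eulerSeries = (1 + C (q ^ 2) * X) * rescale q eulerSeries := by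
  have e : (1 + C (q ^ 2) * X) * rescale q eulerSeries
      = rescale q eulerSeries + X * (C (q ^ 2) * rescale q eulerSeries) := by ring
  rw [e]
  ext1 n
  rcases n with _ | n
  · simp [eulerSeries, constantCoeff_rescale]
  · simp only [eulerSeries, coeff_rescale, map_add, coeff_succ_X_mul, coeff_C_mul, coeff_mk]
    linear_combination eulerCoeff_succ n

open PowerSeries in
theorem rescale_rescale_eq {R : Type*} [CommRing R] (a b : R) (f : PowerSeries R) :
    rescale a (rescale b f) = rescale (a * b) f := by
  rw [rescale_rescale, mul_comm]

open PowerSeries in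
theorem rescale_C_eq {R : Type*} [CommRing R] (a b : R) : rescale a (C b) = C b := by
  ext n
  rcases n with _ | n <;> simp [coeff_rescale, coeff_C]

open PowerSeries in
-- Three steps z → qz, matching the step z → q³z of `halfSeries`.
theorem eulerSeries_eq_mul_rescale_cube :
    eulerSeries = (1 + C (q ^ 2) * X) * (1 + C (q ^ 3) * X) * (1 + C (q ^ 4) * X)
      * rescale (q ^ 3) eulerSeries := by
  have h1 := congrArg (rescale q) eulerSeries_eq_mul_rescale
  have h2 := congrArg (rescale q) h1
  simp only [map_mul, map_add, map_one, rescale_rescale_eq, rescale_C_eq, rescale_X] at h1 h2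
  conv_lhs => rw [eulerSeries_eq_mul_rescale, h1, h2]
  rw [show q * (q * q) = q ^ 3 by ring]
  simp only [map_pow]
  ring

/-- The product of Euler's series and two copies of `halfSeries`, one of them at `z q`. -/
noncomputable def tripleSeries : PowerSeries Series :=
  eulerSeries * (halfSeries * PowerSeries.rescale q halfSeries)

open PowerSeries in
-- The factors 1 + q³z and 1 + q⁴z produced by H(z) and H(qz) cancel two of the three factors of E.
theorem tripleSeries_functional_equation :
    (1 + C (q ^ 2) * X) * rescale (q ^ 3) tripleSeries
      = (1 - X) * (1 - C q * X) * tripleSeries := by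
  have h1 := congrArg (rescale q) rescale_halfSeries
  simp only [map_mul, map_add, map_sub, map_one, rescale_rescale_eq, rescale_C_eq, rescale_X] at h1
  have hne : ∀ a : Series, (1 + C a * X : PowerSeries Series) ≠ 0 := fun a h => by
    simpa using congrArg (constantCoeff (R := Series)) h
  apply mul_left_cancel₀ (mul_ne_zero (hne (q ^ 3)) (hne (q ^ 4)))
  rw [tripleSeries]
  conv_rhs => rw [eulerSeries_eq_mul_rescale_cube]
  simp only [map_mul, rescale_rescale_eq]
  rw [mul_comm (q ^ 3) q, h1, rescale_halfSeries]
  simp only [map_pow]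
  ring

/-- The coefficients of `tripleSeries`. -/
noncomputable def tripleCoeff (k : ℕ) : Series := PowerSeries.coeff k tripleSeries

theorem tripleCoeff_zero : tripleCoeff 0 = 1 := by
  simp [tripleCoeff, tripleSeries, eulerSeries, halfSeries, eulerCoeff, halfCoeff, qPochhammer,
    recip_one, constantCoeff_rescale]

open PowerSeries in
theorem tripleSeries_functional_equation_expanded :
    rescale (q ^ 3) tripleSeries + X * (C (q ^ 2) * rescale (q ^ 3) tripleSeries)
      = tripleSeries - X * (C (1 + q) * tripleSeries) + X * (X * (C q * tripleSeries)) := by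
  have h := tripleSeries_functional_equation
  simp only [map_add, map_one]
  linear_combination h

theorem tripleCoeff_one : (1 - q ^ 3) * tripleCoeff 1 = 1 + q + q ^ 2 := by
  have h := congrArg (PowerSeries.coeff (R := Series) (0 + 1))
    tripleSeries_functional_equation_expanded
  rw [map_add, map_add, map_sub] at h
  simp only [PowerSeries.coeff_succ_X_mul, PowerSeries.coeff_C_mul,
    PowerSeries.coeff_rescale, PowerSeries.coeff_zero_X_mul] at h
  have h0 : PowerSeries.coeff 0 tripleSeries = 1 := tripleCoeff_zero
  rw [h0, zero_add] at h
  rw [tripleCoeff]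
  linear_combination -h

open PowerSeries in
theorem tripleCoeff_recurrence (k : ℕ) :
    (1 - q ^ (3 * k + 6)) * tripleCoeff (k + 2)
      = (1 + q + q ^ (3 * k + 5)) * tripleCoeff (k + 1) - q * tripleCoeff k := by
  have h := congrArg (coeff (R := Series) (k + 2)) tripleSeries_functional_equation_expanded
  rw [map_add, map_add, map_sub] at h
  simp only [coeff_succ_X_mul, coeff_C_mul, coeff_rescale, ← pow_mul] at h
  rw [tripleCoeff, tripleCoeff, tripleCoeff]
  linear_combination -h

theorem tripleCoeff_eq_sum (k : ℕ) :
    tripleCoeff k = ∑ p ∈ Finset.HasAntidiagonal.antidiagonal k, ∑ r ∈ Finset.HasAntidiagonal.antidiagonal p.2,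
      eulerCoeff p.1 * (halfCoeff r.1 * (q ^ r.2 * halfCoeff r.2)) := by
  simp only [tripleCoeff, tripleSeries, PowerSeries.coeff_mul, eulerSeries, halfSeries,
    PowerSeries.coeff_mk, PowerSeries.coeff_rescale, Finset.mul_sum]

/-! ### The coefficient of `x ^ k` in the triple sum -/

theorem A_eq (n₁ n₂ m : ℕ) :
    A n₁ n₂ m = (n₁ + n₂ + m) + 3 * (n₁ + n₂ + m).choose 2 + (m.choose 2 + 2 * m) + n₂ := by
  -- Over ℚ the floor division and truncated subtraction become exact, and `ring` applies.
  have h : (A n₁ n₂ m : ℚ)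
      = ((n₁ + n₂ + m) + 3 * (n₁ + n₂ + m).choose 2 + (m.choose 2 + 2 * m) + n₂ : ℕ) := by
    rw [A_cast]
    push_cast [Nat.cast_choose_two]
    ring
  exact_mod_cast h

theorem summand_eq (n₁ n₂ m : ℕ) :
    summand n₁ n₂ m = x ^ (n₁ + n₂ + m)
      * (q ^ ((n₁ + n₂ + m) + 3 * (n₁ + n₂ + m).choose 2)
        * (eulerCoeff m * (halfCoeff n₁ * (q ^ n₂ * halfCoeff n₂)))) := by
  have h6 : MvPowerSeries.constantCoeff (q ^ 6) = 0 := constantCoeff_q_pow (by norm_num)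
  have c1 := constantCoeff_qPochhammer h6 (q ^ 6) (n₁ / 2)
  have c2 := constantCoeff_qPochhammer h6 (q ^ 6) (n₂ / 2)
  have c3 := constantCoeff_qPochhammer constantCoeff_q q m
  rw [summand, denom, recip_mul (by rw [map_mul, c1, c2, one_mul]) c3, recip_mul c1 c2, A_eq,
    pow_add q _ n₂, pow_add q _ (m.choose 2 + 2 * m), eulerCoeff, halfCoeff, halfCoeff]
  ring

theorem sum_summand (k : ℕ) :
    ∑ p ∈ Finset.HasAntidiagonal.antidiagonal k, ∑ r ∈ Finset.HasAntidiagonal.antidiagonal p.2, summand r.1 r.2 p.1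
      = x ^ k * (q ^ (k + 3 * k.choose 2) * tripleCoeff k) := by
  rw [tripleCoeff_eq_sum, Finset.mul_sum, Finset.mul_sum]
  refine Finset.sum_congr rfl fun p hp => ?_
  rw [Finset.mul_sum, Finset.mul_sum]
  refine Finset.sum_congr rfl fun r hr => ?_
  rw [Finset.HasAntidiagonal.mem_antidiagonal] at hp hr
  rw [summand_eq, show r.1 + r.2 + p.1 = k by omega]

/-! ### The partition side -/

/-- Schur's condition on two neighbouring parts. -/
def Gap (a b : ℕ) : Prop := a + 3 ≤ b ∧ (3 ∣ a → 3 ∣ b → a + 6 ≤ b)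

/-- Schur partitions of `n` into `k` parts, as increasing lists, with all parts greater
than `j`. -/
def schurLists (j k n : ℕ) : Set (List ℕ) :=
  {l | l.IsChain Gap ∧ (∀ b ∈ l.head?, j < b) ∧ l.length = k ∧ l.sum = n}

theorem lt_of_mem_of_isChain {j : ℕ} {l : List ℕ} (hc : l.IsChain Gap)
    (hj : ∀ b ∈ l.head?, j < b) : ∀ b ∈ l, j < b := by
  induction l generalizing j with
  | nil => simp
  | cons a l ih =>
    rw [List.isChain_cons] at hc
    have ha : j < a := hj a (by simp)
    intro b hb
    rcases List.mem_cons.1 hb with rfl | hb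
    · exact ha
    · exact ih hc.2 (fun c hc' => by have := (hc.1 c hc').1; omega) b hb

theorem finite_schurLists (j k n : ℕ) : (schurLists j k n).Finite := by
  apply Set.Finite.subset (s := List.ofFn '' (Finset.Nat.antidiagonalTuple k n : Set (Fin k → ℕ)))
    ((Finset.finite_toSet _).image _)
  rintro l ⟨-, -, rfl, rfl⟩
  refine ⟨l.get, ?_, List.ofFn_get l⟩
  rw [Finset.mem_coe, Finset.Nat.mem_antidiagonalTuple, ← List.sum_ofFn, List.ofFn_get]

/-- Either the smallest part exceeds `j + 1`, or it equals `j + 1` and is removed. By `ht` the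
admissible next parts are exactly those above `t`, so the tail is again of the same kind. -/
theorem schurLists_succ {j t : ℕ} (ht : ∀ b, Gap (j + 1) b ↔ t < b) (k n : ℕ) :
    schurLists j (k + 1) n = schurLists (j + 1) (k + 1) n
      ∪ (if j + 1 ≤ n then List.cons (j + 1) '' schurLists t k (n - (j + 1)) else ∅) := by
  ext l
  rcases l with _ | ⟨a, l⟩
  · split_ifs <;> simp [schurLists]
  · have h : (a :: l ∈ (if j + 1 ≤ n then List.cons (j + 1) '' schurLists t k (n - (j + 1)) else ∅))
        ↔ j + 1 ≤ n ∧ a = j + 1 ∧ l ∈ schurLists t k (n - (j + 1)) := by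
      split_ifs with hn <;> simp [hn]
      tauto
    rw [Set.mem_union, h]
    simp only [schurLists, Set.mem_ofPred_eq, List.isChain_cons, List.head?_cons, Option.mem_def,
      Option.some.injEq, forall_eq', List.length_cons, List.sum_cons]
    constructor
    · rintro ⟨⟨h1, h2⟩, h3, h4, h5⟩
      rcases Nat.lt_or_ge (j + 1) a with hlt | hge
      · exact Or.inl ⟨⟨h1, h2⟩, hlt, h4, h5⟩
      · obtain rfl : a = j + 1 := by omega
        exact Or.inr ⟨by omega, rfl, h2, fun b hb => (ht b).1 (h1 b hb), by omega, by omega⟩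
    · rintro (⟨h1, h3, h4, h5⟩ | ⟨hn, rfl, h2, h1, h4, h5⟩)
      · exact ⟨h1, by omega, h4, h5⟩
      · exact ⟨⟨fun b hb => (ht b).2 (h1 b hb), h2⟩, by omega, by omega, by omega⟩

theorem ncard_schurLists_succ {j t : ℕ} (ht : ∀ b, Gap (j + 1) b ↔ t < b) (k n : ℕ) :
    (schurLists j (k + 1) n).ncard = (schurLists (j + 1) (k + 1) n).ncard
      + if j + 1 ≤ n then (schurLists t k (n - (j + 1))).ncard else 0 := by
  rw [schurLists_succ ht]
  split_ifs with hn
  · rw [Set.ncard_union_eq _ (finite_schurLists _ _ _) ((finite_schurLists _ _ _).image _),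
      Set.ncard_image_of_injective _ List.cons_injective]
    rw [Set.disjoint_left]
    rintro _ ⟨-, h, -⟩ ⟨l, -, rfl⟩
    simp at h
  · simp

/-- The condition sees only the difference and the residues mod 3. This shift closes the recursion.
-/
theorem gap_add_three (a b : ℕ) : Gap (a + 3) (b + 3) ↔ Gap a b := by
  simp only [Gap]
  omega

theorem map_add_three_mem_schurLists {j k n : ℕ} {l : List ℕ} :
    l.map (· + 3) ∈ schurLists (j + 3) k (n + 3 * k) ↔ l ∈ schurLists j k n := by
  have hs : (l.map (· + 3)).sum = l.sum + 3 * l.length := by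
    induction l with
    | nil => rfl
    | cons a l ih => simp only [List.map_cons, List.sum_cons, List.length_cons, ih]; ring
  simp only [schurLists, Set.mem_ofPred_eq, List.isChain_map, gap_add_three, List.head?_map,
    List.length_map, hs]
  refine and_congr_right fun _ => and_congr ?_ (and_congr_right ?_)
  · cases l.head? <;> simp
  · rintro rfl
    omega

theorem exists_map_add_three {j k n : ℕ} {l : List ℕ} (hl : l ∈ schurLists (j + 3) k n) :
    ∃ l' : List ℕ, l'.map (· + 3) = l := by
  have h := lt_of_mem_of_isChain hl.1 hl.2.1
  refine ⟨l.map (· - 3), ?_⟩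
  rw [List.map_map]
  conv_rhs => rw [← List.map_id l]
  refine List.map_congr_left fun b hb => ?_
  have := h b hb
  simp only [Function.comp_apply, id]
  omega

theorem ncard_schurLists_add_three (j k n : ℕ) :
    (schurLists (j + 3) k n).ncard
      = if 3 * k ≤ n then (schurLists j k (n - 3 * k)).ncard else 0 := by
  split_ifs with hn
  · obtain ⟨n, rfl⟩ := Nat.exists_eq_add_of_le' hn
    rw [Nat.add_sub_cancel, ← Set.ncard_image_of_injective (schurLists j k n)
      (f := List.map (· + 3)) (List.map_injective_iff.2 (add_left_injective 3))]
    congr 1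
    ext l
    constructor
    · intro hl
      obtain ⟨l, rfl⟩ := exists_map_add_three hl
      exact ⟨l, map_add_three_mem_schurLists.1 hl, rfl⟩
    · rintro ⟨l, hl, rfl⟩
      exact map_add_three_mem_schurLists.2 hl
  · rw [Set.ncard_eq_zero (finite_schurLists _ _ _), Set.eq_empty_iff_forall_notMem]
    intro l hl
    have h := lt_of_mem_of_isChain hl.1 hl.2.1
    have := List.card_nsmul_le_sum l 3 fun b hb => by have := h b hb; omega
    rw [hl.2.2.1, hl.2.2.2, smul_eq_mul] at this
    omega

theorem sort_eq_self_of_isChain {l : List ℕ} (hl : l.IsChain Gap) :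
    (l : Multiset ℕ).sort (· ≤ ·) = l := by
  rw [Multiset.coe_sort]
  exact List.mergeSort_eq_self _ (List.IsChain.pairwise (hl.imp fun a b h => by have := h.1; omega))

theorem schurCount_eq_ncard (k n : ℕ) : schurCount k n = (schurLists 0 k n).ncard := by
  rw [schurCount, ← Nat.card_eq_fintype_card, ← Nat.card_coe_set_eq]
  refine Nat.card_congr
    { toFun p := ⟨p.1.parts.sort (· ≤ ·), p.2.1, fun b hb => ?_, ?_, ?_⟩
      invFun l := ⟨⟨(l.1 : Multiset ℕ), fun {b} hb => ?_, ?_⟩, ?_, ?_⟩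
      left_inv p := ?_
      right_inv l := ?_ }
  · exact p.1.parts_pos ((Multiset.mem_sort _).1 (List.mem_of_mem_head? hb))
  · rw [Multiset.length_sort, p.2.2]
  · rw [← Multiset.sum_coe, Multiset.sort_eq, p.1.parts_sum]
  · exact lt_of_mem_of_isChain l.2.1 l.2.2.1 b (Multiset.mem_coe.1 hb)
  · rw [Multiset.sum_coe, l.2.2.2.2]
  · rw [IsSchur]
    simp only [sort_eq_self_of_isChain l.2.1]
    exact l.2.1
  · rw [Multiset.coe_card, l.2.2.2.1]
  · apply Subtype.ext
    apply Nat.Partition.ext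
    exact Multiset.sort_eq _ _
  · exact Subtype.ext (sort_eq_self_of_isChain l.2.1)

/-- The generating function, in `q` alone, of the Schur partitions into `k` parts that are all
greater than `j`. -/
noncomputable def partsGF (j k : ℕ) : Series := fun d =>
  if d 0 = 0 then ((schurLists j k (d 1)).ncard : ℤ) else 0

theorem coeff_partsGF (j k : ℕ) (d : Fin 2 →₀ ℕ) : MvPowerSeries.coeff d (partsGF j k)
    = if d 0 = 0 then ((schurLists j k (d 1)).ncard : ℤ) else 0 := rfl

theorem coeff_q_pow_mul_partsGF (i j k : ℕ) (d : Fin 2 →₀ ℕ) :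
    MvPowerSeries.coeff d (q ^ i * partsGF j k)
    = if d 0 = 0 then if i ≤ d 1 then ((schurLists j k (d 1 - i)).ncard : ℤ) else 0 else 0 := by
  rw [q, MvPowerSeries.X_pow_eq, MvPowerSeries.coeff_monomial_mul, one_mul, coeff_partsGF]
  simp [Finsupp.single_le_iff]
  split_ifs <;> rfl

theorem coeff_x_pow_mul_partsGF (i j k : ℕ) (d : Fin 2 →₀ ℕ) :
    MvPowerSeries.coeff d (x ^ i * partsGF j k)
    = if d 0 = i then ((schurLists j k (d 1)).ncard : ℤ) else 0 := by
  rw [x, MvPowerSeries.X_pow_eq, MvPowerSeries.coeff_monomial_mul, one_mul, coeff_partsGF]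
  simp [Finsupp.single_le_iff]
  split_ifs <;> first | rfl | omega

theorem partsGF_zero (j : ℕ) : partsGF j 0 = 1 := by
  ext d
  rw [coeff_partsGF, MvPowerSeries.coeff_one]
  have hs : schurLists j 0 (d 1) = if d 1 = 0 then {[]} else ∅ := by
    ext l
    split_ifs with h <;> rcases l with _ | ⟨a, l⟩ <;> simp [schurLists, h, Ne.symm]
  have hd : d = 0 ↔ d 0 = 0 ∧ d 1 = 0 := by
    rw [Finsupp.ext_iff, Fin.forall_fin_two]; rfl
  rw [hs]
  simp only [hd]
  split_ifs <;> simp_all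

theorem partsGF_succ {j t : ℕ} (ht : ∀ b, Gap (j + 1) b ↔ t < b) (k : ℕ) :
    partsGF j (k + 1) = partsGF (j + 1) (k + 1) + q ^ (j + 1) * partsGF t k := by
  ext d
  rw [map_add, coeff_q_pow_mul_partsGF, coeff_partsGF, coeff_partsGF, ncard_schurLists_succ ht]
  split_ifs <;> simp

theorem partsGF_add_three (j k : ℕ) : partsGF (j + 3) k = q ^ (3 * k) * partsGF j k := by
  ext d
  rw [coeff_q_pow_mul_partsGF, coeff_partsGF, ncard_schurLists_add_three]
  split_ifs <;> simp

theorem partsGF_zero_succ (k : ℕ) :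
    partsGF 0 (k + 1) = partsGF 1 (k + 1) + q ^ (3 * k + 1) * partsGF 0 k := by
  rw [partsGF_succ (t := 0 + 3) (fun b => by simp only [Gap]; omega), partsGF_add_three]
  ring

theorem partsGF_one_succ (k : ℕ) :
    partsGF 1 (k + 1) = partsGF 2 (k + 1) + q ^ (3 * k + 2) * partsGF 1 k := by
  rw [partsGF_succ (t := 1 + 3) (fun b => by simp only [Gap]; omega), partsGF_add_three]
  ring

/-- After a part 3 the next part cannot be 6 but can be 7, hence the threshold 6 and two shifts by
3. -/
theorem partsGF_two_succ (k : ℕ) :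
    partsGF 2 (k + 1) = q ^ (3 * k + 3) * partsGF 0 (k + 1) + q ^ (6 * k + 3) * partsGF 0 k := by
  rw [partsGF_succ (t := 0 + 3 + 3) (fun b => by simp only [Gap]; omega), partsGF_add_three,
    partsGF_add_three, show 2 + 1 = 0 + 3 by rfl, partsGF_add_three]
  ring

theorem partsGF_one : (1 - q ^ 3) * partsGF 0 1 = q + q ^ 2 + q ^ 3 := by
  have h0 := partsGF_zero_succ 0
  have h1 := partsGF_one_succ 0
  have h2 := partsGF_two_succ 0
  simp only [partsGF_zero, zero_add, mul_zero, pow_one, mul_one] at h0 h1 h2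
  linear_combination h0 + h1 + h2

theorem partsGF_recurrence (k : ℕ) :
    (1 - q ^ (3 * k + 6)) * partsGF 0 (k + 2)
      = (q ^ (3 * k + 4) + q ^ (3 * k + 5) + q ^ (6 * k + 9)) * partsGF 0 (k + 1)
        - q ^ (6 * k + 6) * partsGF 0 k := by
  have h0 := partsGF_zero_succ (k + 1)
  have h1 := partsGF_one_succ (k + 1)
  have h2 := partsGF_two_succ (k + 1)
  -- The sum eliminates `partsGF 1 (k + 2)` and `partsGF 2 (k + 2)`; the last term removes the
  -- remaining `partsGF 1 (k + 1)`.
  linear_combination h0 + h1 + h2 - q ^ (3 * k + 5) * partsGF_zero_succ k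

/-! ### Comparison -/

theorem one_sub_q_pow_ne_zero {n : ℕ} (hn : n ≠ 0) : (1 - q ^ n : Series) ≠ 0 := fun h => by
  simpa [q, hn] using congrArg MvPowerSeries.constantCoeff h

theorem partsGF_eq_tripleCoeff (k : ℕ) :
    partsGF 0 k = q ^ (k + 3 * k.choose 2) * tripleCoeff k := by
  induction k using Nat.twoStepInduction with
  | zero => simp [partsGF_zero, tripleCoeff_zero]
  | one =>
    apply mul_left_cancel₀ (one_sub_q_pow_ne_zero (n := 3) (by norm_num))
    rw [partsGF_one, Nat.choose_eq_zero_of_lt one_lt_two]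
    linear_combination -q * tripleCoeff_one
  | more k ih0 ih1 =>
    apply mul_left_cancel₀ (one_sub_q_pow_ne_zero (n := 3 * k + 6) (by omega))
    have h := tripleCoeff_recurrence k
    rw [partsGF_recurrence, ih0, ih1, choose_two_succ (k + 1), choose_two_succ k]
    -- The exponent is `(k + 2) + 3 * (k + 2).choose 2`, expanded.
    linear_combination -q ^ (k + 2 + 3 * (k + 1 + (k + k.choose 2))) * h

theorem sum_summand_eq_partsGF (k : ℕ) :
    ∑ p ∈ Finset.HasAntidiagonal.antidiagonal k, ∑ r ∈ Finset.HasAntidiagonal.antidiagonal p.2,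
      summand r.1 r.2 p.1 = x ^ k * partsGF 0 k := by
  rw [sum_summand, partsGF_eq_tripleCoeff]

/-! ### Unconditional convergence, coefficient by coefficient -/

theorem coeff_summand_eq_zero {n₁ n₂ m : ℕ} {d : Fin 2 →₀ ℕ} (h : d 0 < n₁ + n₂ + m) :
    MvPowerSeries.coeff d (summand n₁ n₂ m) = 0 := by
  rw [summand, mul_assoc, x, MvPowerSeries.X_pow_eq, MvPowerSeries.coeff_monomial_mul, if_neg]
  rw [Finsupp.single_le_iff]
  omega

/-- The triples `(n₁, n₂, m)` with sum `k`. -/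
def triplesOfSum (k : ℕ) : Finset (ℕ × ℕ × ℕ) :=
  {t ∈ Finset.range (k + 1) ×ˢ Finset.range (k + 1) ×ˢ Finset.range (k + 1) |
    t.1 + t.2.1 + t.2.2 = k}

theorem mem_triplesOfSum {k : ℕ} {t : ℕ × ℕ × ℕ} :
    t ∈ triplesOfSum k ↔ t.1 + t.2.1 + t.2.2 = k := by
  simp only [triplesOfSum, Finset.mem_filter, Finset.mem_product, Finset.mem_range]
  omega

theorem sum_triplesOfSum {M : Type*} [AddCommMonoid M] (k : ℕ) (f : ℕ → ℕ → ℕ → M) :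
    ∑ t ∈ triplesOfSum k, f t.1 t.2.1 t.2.2
      = ∑ p ∈ Finset.HasAntidiagonal.antidiagonal k,
        ∑ r ∈ Finset.HasAntidiagonal.antidiagonal p.2, f r.1 r.2 p.1 := by
  rw [Finset.sum_sigma']
  refine Finset.sum_bij' (fun t _ => ⟨(t.2.2, t.1 + t.2.1), (t.1, t.2.1)⟩)
    (fun s _ => (s.2.1, s.2.2, s.1.1)) ?_ ?_ ?_ ?_ ?_
  · intro t ht
    rw [mem_triplesOfSum] at ht
    simp only [Finset.mem_sigma, Finset.HasAntidiagonal.mem_antidiagonal, and_true]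
    omega
  · intro s hs
    simp only [Finset.mem_sigma, Finset.HasAntidiagonal.mem_antidiagonal] at hs
    rw [mem_triplesOfSum]
    dsimp only
    omega
  · intro t _
    rfl
  · rintro ⟨⟨m, l⟩, ⟨a, b⟩⟩ hs
    simp only [Finset.mem_sigma, Finset.HasAntidiagonal.mem_antidiagonal] at hs
    obtain ⟨-, rfl⟩ := hs
    rfl
  · intro t _
    rfl

theorem hasSum_coeff_summand (d : Fin 2 →₀ ℕ) :
    HasSum (fun n : ℕ × ℕ × ℕ => MvPowerSeries.coeff d (summand n.1 n.2.1 n.2.2))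
      (MvPowerSeries.coeff d schurGF) := by
  have hd : Set.PairwiseDisjoint (Finset.range (d 0 + 1) : Set ℕ) triplesOfSum := by
    intro i _ j _ hij
    rw [Function.onFun, Finset.disjoint_left]
    intro t hi hj
    rw [mem_triplesOfSum] at hi hj
    omega
  have h : MvPowerSeries.coeff d schurGF
      = ∑ t ∈ (Finset.range (d 0 + 1)).biUnion triplesOfSum,
        MvPowerSeries.coeff d (summand t.1 t.2.1 t.2.2) := by
    rw [Finset.sum_biUnion hd]
    simp only [← map_sum, sum_triplesOfSum _ summand, sum_summand_eq_partsGF,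
      coeff_x_pow_mul_partsGF]
    -- Of all `k ≤ d 0`, only `k = d 0` contributes.
    rw [Finset.sum_ite_eq, if_pos (by simp), ← schurCount_eq_ncard]
    rfl
  rw [h]
  refine hasSum_sum_of_ne_finset_zero fun t ht => coeff_summand_eq_zero ?_
  by_contra hlt
  refine ht (Finset.mem_biUnion.2 ⟨_, ?_, mem_triplesOfSum.2 rfl⟩)
  rw [Finset.mem_range]
  omega

end SchurGap

theorem theorem3 :
    HasSum (fun n : ℕ × ℕ × ℕ => SchurGap.summand n.1 n.2.1 n.2.2) SchurGap.schurGF := by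
  rw [MvPowerSeries.WithPiTopology.hasSum_iff_hasSum_coeff]
  exact SchurGap.hasSum_coeff_summand
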